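/- **Conventions.** A morphism of schemes is *of finite presentation* if it is locally of finite presentation, quasi-compact and quasi-separated; *radicial* means universally injective. Write $\kappa(s)$ for the residue field of a point $s$. Let $f:X\to S$ be a morphism of schemes. - An $S$-scheme $i:T\to S$ is *liftable to $X$* if there is a morphism $j:T\to X$ with $f\circ j=i$. It is *quasi-liftable to $X$* if there are a finite, surjective and radicial morphism $\rho:\widetilde T\to T$ and a morphism $j:\widetilde T\to X$ with $f\circ j=i\circ\rho$. - $\mathrm{QRel}(f)\subset S$ (resp. $\mathrm{Rel}(f)\subset S$) is the set of all $f(x)$, for $x\in X$ such that the extension $\kappa(f(x))\subset\kappa(x)$ is purely inseparable (resp. trivial). - A *principal subscheme* of $S$ is a subscheme whose inclusion factors as a closed immersion $S'\to U$ that is locally defined by one equation (any equation, possibly zero), followed by an open immersion $U\to S$. - $S$ is a *Poonen scheme* if for every nonempty open $U\subset S$ and every dominant morphism of finite presentation $g:Y\to U$, one has $\mathrm{QRel}(g)\neq\emptyset$. - The *codimension* of a point $s\in S$ is $\dim\mathcal O_{S,s}$. $S$ is *Jacobson* if its underlying space is, i.e. the closed points of $S$ contained in any closed subset $Z$ are dense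 in $Z$. **Theorem.** Let $S$ be a nonempty Poonen scheme and $f:X\to S$ a dominant morphism of finite presentation. 1. There is a nonempty principal subscheme $S'$ of $S$ that is quasi-liftable to $X$, and even liftable to $X$ if $f$ is smooth. 2. If $S$ is locally noetherian, then $\mathrm{QRel}(f)$ contains a point of codimension $\leq 1$ of $S$; if moreover $f$ is smooth, so does $\mathrm{Rel}(f)$. 3. If $S$ is Jacobson, then $\mathrm{QRel}(f)$ contains a closed point of $S$; if moreover $f$ is smooth, so does $\mathrm{Rel}(f)$. -/

import Mathlib

open CategoryTheory AlgebraicGeometry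

universe u

namespace QuasiLifting

/-- A morphism of schemes is of finite presentation if it is locally of finite presentation,
quasi-compact and quasi-separated. -/
structure IsOfFinitePresentation {X S : Scheme.{u}} (f : X ⟶ S) : Prop where
  locallyOfFinitePresentation : LocallyOfFinitePresentation f
  quasiCompact : QuasiCompact f
  quasiSeparated : QuasiSeparated f

/-- `T` (an `S`-scheme via `i`) is liftable to `X` (an `S`-scheme via `f`). -/
def IsLiftable {X S T : Scheme.{u}} (f : X ⟶ S) (i : T ⟶ S) : Prop :=
  ∃ j : T ⟶ X, j ≫ f = i

/-- `T` (an `S`-scheme via `i`) is quasi-liftable to `X` (an `S`-scheme via `f`): after a finite,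
surjective and radicial (that is, universally injective) morphism `ρ : T' ⟶ T`, it lifts. -/
def IsQuasiLiftable {X S T : Scheme.{u}} (f : X ⟶ S) (i : T ⟶ S) : Prop :=
  ∃ (T' : Scheme.{u}) (ρ : T' ⟶ T) (j : T' ⟶ X),
    IsFinite ρ ∧ Surjective ρ ∧ UniversallyInjective ρ ∧ j ≫ f = ρ ≫ i

/-- The points of `X` whose residue field is a purely inseparable (radicial) extension of the
residue field of their image. -/
def QRelSource {X S : Scheme.{u}} (f : X ⟶ S) : Set X :=
  {x | (f.residueFieldMap x).hom.IsPurelyInseparable}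

/-- The points of `X` whose residue field is a trivial extension of the residue field of their
image. -/
def RelSource {X S : Scheme.{u}} (f : X ⟶ S) : Set X :=
  {x | Function.Bijective (f.residueFieldMap x).hom}

/-- The set of points of `S` that are quasi-liftable to `X`. -/
def QRel {X S : Scheme.{u}} (f : X ⟶ S) : Set S :=
  f '' QRelSource f

/-- The set of points of `S` that are liftable to `X`. -/
def Rel {X S : Scheme.{u}} (f : X ⟶ S) : Set S :=
  f '' RelSource f

/-- A closed immersion is locally defined by one equation if every point of the target has an
affine open neighbourhood on which the ideal of the closed subscheme is principal. The generator
is arbitrary (it may be zero, a zero divisor or a unit). -/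
structure IsClosedImmersionByOneEquation {X U : Scheme.{u}} (i : X ⟶ U) : Prop where
  isClosedImmersion : IsClosedImmersion i
  exists_principal : ∀ x : U, ∃ V : U.affineOpens, x ∈ V.1 ∧ (i.ker.ideal V).IsPrincipal

/-- A principal immersion: a closed immersion locally defined by one equation, followed by an open
immersion. A principal subscheme is the source of such a morphism. -/
def IsPrincipalImmersion {X Y : Scheme.{u}} (g : X ⟶ Y) : Prop :=
  ∃ (U : Scheme.{u}) (i : X ⟶ U) (j : U ⟶ Y),
    IsClosedImmersionByOneEquation i ∧ IsOpenImmersion j ∧ i ≫ j = g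

/-- `S` is a Poonen scheme: for every nonempty open `U` of `S` and every dominant morphism of finite
presentation `f : X ⟶ U`, some point of `U` is quasi-liftable to `X`. -/
def IsPoonenScheme (S : Scheme.{u}) : Prop :=
  ∀ (U : S.Opens), (U : Set S).Nonempty →
    ∀ (X : Scheme.{u}) (f : X ⟶ (U : Scheme.{u})),
      IsOfFinitePresentation f → IsDominant f → (QRel f).Nonempty

end QuasiLifting

/-!
A nonempty scheme has an affine open subscheme `Spec A`, and `A` has a minimal prime `p`. A dominant
quasi-compact morphism `f : X ⟶ S` hits the corresponding generic point, so `X` contains an affine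
chart `Spec B` over `Spec A` with a point over `p` (`exists_affine_chart_over_minimalPrime`). The
proof first lifts étale-locally around `p` and then removes the étale extension by means of the
Poonen property.

*Étale-local lifting.* By the Nullstellensatz, `B` has a point over `p` in a finite extension `F` of
`κ(p)`, and some `q ^ e`-th powers of the coordinates of this point are separable over `κ(p)`, where
`q` is the characteristic exponent. Separable elements of `F` are realised by an étale `A`-algebra,
so after an étale extension the coordinates satisfy equations `b * x ^ q ^ e = a`. The closed
subscheme of `Spec B` cut out by them is, near `p`, finite, surjective and radicial over the base:
surjective because a constructible set which contains a minimal prime is a neighbourhood of it,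
radicial because the characteristic becomes nilpotent near `p`. This is
`exists_etale_finite_radicial`. If `B` is smooth over `A`, the point can be chosen in a separable
closure of `κ(p)`. Then `e = 0`, the finite radicial morphism is a nilpotent closed immersion, and
the lift extends over it by formal smoothness (`exists_etale_algHom_of_smooth`).

*Removing the étale extension.* Let `E` be a nonzero étale `A`-algebra. The Poonen property, applied
to `Spec E` over its open image in `S`, gives a point of `Spec E` whose residue extension is purely
inseparable, hence trivial since `E` is étale
(`QuasiLifting.IsPoonenScheme.exists_algHom_residueField`). Near this point `E` is standard étale,
`E = (A[x] / f)` localised at some `g`. The value of `x` at the point is a fraction `a / b` with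
`a, b` in `A`, and `x ↦ a / b` defines a section of `Spec E` over the locus where the single
function `f (a / b)` vanishes, inside the open set where `b` and `g (a / b)` are invertible
(`exists_localization_lift_of_etale`). This locus is a nonempty principal subscheme.

The last two assertions follow from the first, because all points of a quasi-liftable (liftable)
subscheme belong to `QRel f` (`Rel f`): the first by Krull's principal ideal theorem, the second
because a nonempty locally closed subset of a Jacobson space contains a closed point.
-/

/-! ### Separable residue extensions and neighbourhoods of minimal primes -/

open Polynomial in
/-- The derivative of `m.scaleRoots r` is `(derivative m).scaleRoots r` up to a power of `r`. -/
lemma separable_scaleRoots {K : Type*} [Field K] {m : K[X]} (hm : m.Separable) {r : K}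
    (hr : IsUnit r) : (m.scaleRoots r).Separable := by
  have h : derivative (m.scaleRoots r) =
      C (r ^ (m.natDegree - 1 - (derivative m).natDegree)) * (derivative m).scaleRoots r := by
    ext i
    simp only [coeff_derivative, coeff_scaleRoots, coeff_C_mul]
    rcases le_or_gt i (derivative m).natDegree with hi | hi
    · have := natDegree_derivative_le m
      rw [show m.natDegree - (i + 1) =
        (m.natDegree - 1 - (derivative m).natDegree) + ((derivative m).natDegree - i) by omega,
        pow_add]
      ring
    · have := coeff_eq_zero_of_natDegree_lt hi
      rw [coeff_derivative] at this
      rw [this, mul_right_comm, this]; simp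
  rw [Polynomial.Separable, h]
  exact (isCoprime_mul_unit_left_right ((hr.pow _).map C) _ _).mpr
    (isCoprime_scaleRoots _ _ _ hr hm)

open Polynomial in
/-- An element `t` separable over `κ(p)` becomes, after multiplication by some `c ∉ p`, a simple
root of a monic polynomial over `A`: take for `c` a common denominator of the coefficients of the
minimal polynomial of `t`, and lift the minimal polynomial of `c * t`. -/
lemma exists_monic_lift_of_isSeparable {A F : Type*} [CommRing A] [Field F] [Algebra A F]
    (p : Ideal A) [p.IsPrime] [Algebra p.ResidueField F] [IsScalarTower A p.ResidueField F]
    {t : F} (ht : IsSeparable p.ResidueField t) :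
    ∃ (f : A[X]) (c : A), c ∉ p ∧ f.Monic ∧ aeval (algebraMap A F c * t) f = 0 ∧
      aeval (algebraMap A F c * t) (derivative f) ≠ 0 := by
  set K := p.ResidueField
  set m := minpoly K t
  have hm : m.Monic := minpoly.monic ht.isIntegral
  set b := IsLocalization.commonDenom (nonZeroDivisors (A ⧸ p)) m.support m.coeff
  have hlift : m.scaleRoots (algebraMap (A ⧸ p) K b) ∈ lifts (algebraMap (A ⧸ p) K) :=
    IsLocalization.scaleRoots_commonDenom_mem_lifts _ _ (by
      rw [hm.leadingCoeff]; exact one_mem _)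
  obtain ⟨c, hc⟩ := Ideal.Quotient.mk_surjective b.1
  have hcK : algebraMap (A ⧸ p) K b = algebraMap A K c := by
    rw [← hc]; rfl
  have hcp : c ∉ p := by
    intro h
    rw [Ideal.Quotient.eq_zero_iff_mem.mpr h] at hc
    exact nonZeroDivisors.coe_ne_zero b hc.symm
  have hc0 : algebraMap A K c ≠ 0 := by rwa [Ne, Ideal.algebraMap_residueField_eq_zero]
  rw [hcK] at hlift
  have hlift' : m.scaleRoots (algebraMap A K c) ∈ lifts (algebraMap A K) := by
    rw [lifts_iff_coeff_lifts] at hlift ⊢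
    intro n
    obtain ⟨y, hy⟩ := hlift n
    obtain ⟨a, rfl⟩ := Ideal.Quotient.mk_surjective y
    exact ⟨a, hy⟩
  obtain ⟨f, hf, -, hfm⟩ := lifts_and_degree_eq_and_monic hlift' ((monic_scaleRoots_iff _).mpr hm)
  have key (g : A[X]) : aeval (algebraMap A F c * t) g =
      aeval (algebraMap K F (algebraMap A K c) * t) (g.map (algebraMap A K)) := by
    rw [aeval_map_algebraMap, ← IsScalarTower.algebraMap_apply A K F]
  have hroot :
      aeval (algebraMap K F (algebraMap A K c) * t) (m.scaleRoots (algebraMap A K c)) = 0 :=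
    scaleRoots_aeval_eq_zero (minpoly.aeval K t)
  refine ⟨f, c, hcp, hfm, ?_, ?_⟩
  · rw [key, hf, hroot]
  · have hsep : (m.scaleRoots (algebraMap A K c)).Separable :=
      separable_scaleRoots ht hc0.isUnit
    rw [key, ← derivative_map, hf]
    exact hsep.aeval_derivative_ne_zero hroot

/-- Primes over a minimal prime are minimal in a quasi-finite algebra, since distinct primes of a
fibre are incomparable. -/
lemma mem_minimalPrimes_of_under_mem_minimalPrimes {A A' : Type*} [CommRing A] [CommRing A']
    [Algebra A A'] [Algebra.QuasiFinite A A'] (q : Ideal A') [q.IsPrime]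
    (h : q.under A ∈ minimalPrimes A) : q ∈ minimalPrimes A' := by
  refine ⟨⟨‹_›, bot_le⟩, fun r hr hrq ↦ ?_⟩
  have := hr.1
  have h1 : r.under A = q.under A :=
    le_antisymm (Ideal.comap_mono hrq) (h.2 ⟨inferInstance, bot_le⟩ (Ideal.comap_mono hrq))
  exact (Algebra.QuasiFinite.eq_of_le_of_under_eq r q hrq h1).ge

open Polynomial in
/-- Finitely many elements separable over `κ(p)` are realised by an étale algebra: they are
fractions of values of its elements. The algebra is standard étale, given by a primitive element of the
extension of `κ(p)` that they generate. -/
lemma exists_etale_subset_closure_range {A F : Type u} [CommRing A] [Field F] [Algebra A F]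
    (p : Ideal A) [p.IsPrime] [Algebra p.ResidueField F] [IsScalarTower A p.ResidueField F]
    (s : Set F) (hs : s.Finite) (hsep : ∀ y ∈ s, IsSeparable p.ResidueField y) :
    ∃ (A' : Type u) (_ : CommRing A') (_ : Algebra A A') (_ : Algebra.Etale A A')
      (φ : A' →ₐ[A] F), s ⊆ Subfield.closure (Set.range φ) := by
  set K := p.ResidueField
  let E := IntermediateField.adjoin K s
  have : Algebra.IsSeparable K E :=
    (IntermediateField.isSeparable_adjoin_iff_isSeparable K F).mpr hsep
  have := hs.to_subtype
  have : FiniteDimensional K E :=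
    IntermediateField.finiteDimensional_adjoin fun y hy ↦ (hsep y hy).isIntegral
  obtain ⟨t, ht⟩ := Field.exists_primitive_element K E
  obtain ⟨f, c, hcp, hfm, h0, h1⟩ := exists_monic_lift_of_isSeparable (F := F) p (t := t.1)
    (by
      have := Algebra.IsSeparable.isSeparable K t
      rwa [IsSeparable, ← minpoly.algebraMap_eq (algebraMap E F).injective] at this)
  let P : StandardEtalePair A := ⟨f, hfm, derivative f, 1, 0, 1, by simp⟩
  have hP : P.HasMap (algebraMap A F c * t.1) := ⟨h0, h1.isUnit⟩
  refine ⟨P.Ring, inferInstance, inferInstance, inferInstance, P.lift _ hP, ?_⟩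
  set L := Subfield.closure (Set.range (P.lift _ hP))
  have hA (a : A) : algebraMap A F a ∈ L :=
    Subfield.subset_closure ⟨algebraMap A _ a, by simp⟩
  have hK (k : K) : algebraMap K F k ∈ L := by
    obtain ⟨x, y, hy, rfl⟩ := IsFractionRing.div_surjective (A := A ⧸ p) k
    obtain ⟨x, rfl⟩ := Ideal.Quotient.mk_surjective x
    obtain ⟨y, rfl⟩ := Ideal.Quotient.mk_surjective y
    rw [map_div₀]
    refine div_mem ?_ ?_
    · have := hA x
      rwa [IsScalarTower.algebraMap_apply A K F] at this
    · have := hA y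
      rwa [IsScalarTower.algebraMap_apply A K F] at this
  have hc0 : algebraMap A F c ≠ 0 := by
    rw [IsScalarTower.algebraMap_apply A K F, Ne, map_eq_zero]
    rwa [Ideal.algebraMap_residueField_eq_zero]
  have htL : t.1 ∈ L := by
    have h : algebraMap A F c * t.1 ∈ L := Subfield.subset_closure ⟨P.X, by simp⟩
    have := mul_mem (inv_mem (hA c)) h
    rwa [inv_mul_cancel_left₀ hc0] at this
  let L' : IntermediateField K F := L.toIntermediateField hK
  have hEL : E ≤ L' := by
    have : (IntermediateField.lift (IntermediateField.adjoin K {t}) : IntermediateField K F) ≤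
        L' := by
      rw [IntermediateField.lift_adjoin, IntermediateField.adjoin_le_iff]
      simpa using show t.1 ∈ L' from htL
    rwa [ht, IntermediateField.lift_top] at this
  exact fun y hy ↦ hEL (IntermediateField.subset_adjoin K s hy)

/-- An element of a minimal prime becomes nilpotent on a basic open neighbourhood of it. -/
lemma exists_isNilpotent_mul_of_mem_minimalPrimes {R : Type*} [CommRing R] {p : Ideal R}
    (hp : p ∈ minimalPrimes R) {x : R} (hx : x ∈ p) : ∃ y ∉ p, IsNilpotent (x * y) := by
  have := hp.1.1
  have hn : IsNilpotent (algebraMap R (Localization.AtPrime p) x) := by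
    rw [nilpotent_iff_mem_prime]
    intro q hq
    have := IsLocalization.subsingleton_primeSpectrum_of_mem_minimalPrimes p hp
      (Localization.AtPrime p)
    have h : (⟨q, hq⟩ : PrimeSpectrum (Localization.AtPrime p)) =
        ⟨IsLocalRing.maximalIdeal _, inferInstance⟩ := Subsingleton.elim _ _
    have h' : q = IsLocalRing.maximalIdeal _ := congr_arg PrimeSpectrum.asIdeal h
    rw [h']
    exact (IsLocalization.AtPrime.to_map_mem_maximal_iff _ p x).mpr hx
  obtain ⟨n, hn⟩ := hn
  rw [← map_pow, IsLocalization.map_eq_zero_iff p.primeCompl] at hn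
  obtain ⟨y, hy⟩ := hn
  refine ⟨y, y.2, n + 1, ?_⟩
  rw [mul_pow, pow_succ, pow_succ, show x ^ n * x * ((y : R) ^ n * y) = x * y ^ n * (y * x ^ n) by
    ring, hy, mul_zero]

open PrimeSpectrum in
/-- A constructible subset of a spectrum containing a minimal prime is a neighbourhood of it. -/
lemma exists_basicOpen_subset_of_isConstructible {R : Type*} [CommRing R]
    {Z : Set (PrimeSpectrum R)} (hZ : Topology.IsConstructible Z) {p : PrimeSpectrum R}
    (hp : p.asIdeal ∈ minimalPrimes R) (hpZ : p ∈ Z) :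
    ∃ h ∉ p.asIdeal, (basicOpen h : Set (PrimeSpectrum R)) ⊆ Z := by
  obtain ⟨S, rfl⟩ := exists_constructibleSetData_iff.mpr hZ
  simp only [ConstructibleSetData.toSet, Set.mem_iUnion] at hpZ
  obtain ⟨C, hC, hpC⟩ := hpZ
  have hg (i : Fin C.n) : ∃ y ∉ p.asIdeal, IsNilpotent (C.g i * y) := by
    have hmem : C.g i ∈ p.asIdeal := hpC.1 ⟨i, rfl⟩
    exact exists_isNilpotent_mul_of_mem_minimalPrimes hp hmem
  choose y hy hn using hg
  refine ⟨C.f * ∏ i, y i, p.2.mul_notMem ?_ ?_, ?_⟩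
  · simpa using hpC.2
  · rw [Ideal.IsPrime.prod_mem_iff]; simpa using hy
  · intro q hq
    simp only [ConstructibleSetData.toSet, Set.mem_iUnion]
    have hq' : C.f * ∏ i, y i ∉ q.asIdeal := hq
    refine ⟨C, hC, ?_, fun h ↦ hq' (Ideal.mul_mem_right _ _ (by simpa using h))⟩
    rintro _ ⟨i, rfl⟩
    refine (q.2.mem_or_mem (?_ : C.g i * y i ∈ q.asIdeal)).resolve_right fun h ↦ hq' ?_
    · exact nilpotent_iff_mem_prime.mp (hn i) _ q.2
    · exact Ideal.mul_mem_left _ _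
        (Ideal.mem_of_dvd _ (Finset.dvd_prod_of_mem y (Finset.mem_univ i)) h)

/-! ### Finite radicial surjective morphisms near a minimal prime -/

open TensorProduct in
/-- Let `φ` be an `F`-valued point of `Spec B` over a minimal prime of `A` such that the `q ^ e`-th
powers of the coordinates of `φ` lie in the fraction field of the image of `A` in `F`, where `q` is
the characteristic exponent of `F`. Then a basic open neighbourhood `Spec A_f` of that prime has a
finite, surjective and radicial cover `Spec D` that maps to `Spec B` over `A`. Radiciality is
expressed by injectivity on points with values in fields. For `e = 0` the cover is a closed
subscheme of `Spec A_f`. -/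
lemma exists_finite_radicial_surjective {A B F : Type u} [CommRing A] [CommRing B] [Field F]
    [Algebra A B] [Algebra A F] [Algebra.FinitePresentation A B] (φ : B →ₐ[A] F)
    (hp : RingHom.ker (algebraMap A F) ∈ minimalPrimes A)
    (s : Finset B) (hs : Algebra.adjoin A (s : Set B) = ⊤) (e : ℕ)
    (he : ∀ x ∈ s, φ x ^ ringExpChar F ^ e ∈ Subfield.closure (Set.range (algebraMap A F))) :
    ∃ f : A, algebraMap A F f ≠ 0 ∧
      ∃ (D : Type u) (_ : CommRing D) (_ : Algebra (Localization.Away f) D) (ψ : B →+* D),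
        Algebra.FinitePresentation (Localization.Away f) D ∧
        Module.Finite (Localization.Away f) D ∧
        Function.Surjective (PrimeSpectrum.comap (algebraMap (Localization.Away f) D)) ∧
        (∀ (K : Type u) [Field K] (g₁ g₂ : D →+* K), g₁.comp (algebraMap (Localization.Away f) D) =
          g₂.comp (algebraMap (Localization.Away f) D) → g₁ = g₂) ∧
        ψ.comp (algebraMap A B) =
          (algebraMap (Localization.Away f) D).comp (algebraMap A (Localization.Away f)) ∧
        (e = 0 → Function.Surjective (algebraMap (Localization.Away f) D)) := by
  classical
  set q := ringExpChar F
  -- Fractions `a x / b x` which represent the `q ^ e`-th powers of the coordinates `φ x`.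
  have hab (x : B) : ∃ a b : A, algebraMap A F b ≠ 0 ∧
      (x ∈ s → algebraMap A F b * φ x ^ q ^ e = algebraMap A F a) := by
    by_cases hx : x ∈ s
    · obtain ⟨y, hy, z, hz, hyz⟩ := Subfield.mem_closure_iff.mp (he x hx)
      rw [← RingHom.coe_range, Subring.closure_eq] at hy hz
      obtain ⟨a, rfl⟩ := hy
      obtain ⟨b, rfl⟩ := hz
      by_cases hb : algebraMap A F b = 0
      · refine ⟨0, 1, by simp, fun _ ↦ ?_⟩
        rw [← hyz, hb]; simp
      · exact ⟨a, b, hb, fun _ ↦ by rw [← hyz, mul_div_cancel₀ _ hb]⟩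
    · exact ⟨0, 1, by simp, fun h ↦ (hx h).elim⟩
  choose a b hb hrel using hab
  -- `D` is the localization away from some `f` of the quotient of `B` by the relations
  -- `b x * x ^ q ^ e = a x`, through which `φ` factors.
  let J : Ideal B := Ideal.span
    (s.image fun x ↦ algebraMap A B (b x) * x ^ q ^ e - algebraMap A B (a x) : Finset B)
  have hJ : J.FG := ⟨_, rfl⟩
  have hJφ : ∀ y ∈ J, φ y = 0 := by
    intro y hy
    have : J ≤ RingHom.ker φ := by
      rw [Ideal.span_le]
      intro y hy
      simp only [Finset.coe_image, Set.mem_image, Finset.mem_coe] at hy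
      obtain ⟨x, hx, rfl⟩ := hy
      simp [hrel x hx]
    exact this hy
  let D₀ := B ⧸ J
  have : Algebra.FinitePresentation A D₀ := Algebra.FinitePresentation.quotient hJ
  let φ₀ : D₀ →ₐ[A] F := Ideal.Quotient.liftₐ J φ hJφ
  let p : PrimeSpectrum A := ⟨_, hp.1.1⟩
  have hprange : p ∈ Set.range (PrimeSpectrum.comap (algebraMap A D₀)) := by
    refine ⟨⟨RingHom.ker φ₀.toRingHom, RingHom.ker_isPrime _⟩, ?_⟩
    ext x
    change φ₀ (algebraMap A D₀ x) = 0 ↔ algebraMap A F x = 0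
    rw [AlgHom.commutes]
  -- By Chevalley's theorem, `Spec D₀` surjects onto a neighbourhood `h ≠ 0` of `p`.
  obtain ⟨h, hhp, hh⟩ := exists_basicOpen_subset_of_isConstructible
    (PrimeSpectrum.isConstructible_range_comap
      (RingHom.finitePresentation_algebraMap.mpr this)) hp hprange
  -- In positive characteristic, `q` is nilpotent where `y` is invertible, so that all residue
  -- fields there have characteristic `q`.
  obtain ⟨y, hyp, hy⟩ : ∃ y : A, algebraMap A F y ≠ 0 ∧ (q = 1 ∨ IsNilpotent ((q : A) * y)) := by
    by_cases hq : q = 1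
    · exact ⟨1, by simp, .inl hq⟩
    · have hq' : (q : A) ∈ RingHom.ker (algebraMap A F) := by
        have : q = ringChar F := by simp only [q, ringExpChar] at hq ⊢; omega
        rw [RingHom.mem_ker, map_natCast, this, CharP.cast_eq_zero]
      obtain ⟨y, hy, hn⟩ := exists_isNilpotent_mul_of_mem_minimalPrimes hp hq'
      exact ⟨y, hy, .inr hn⟩
  let f : A := h * y * ∏ x ∈ s, b x
  have hf : algebraMap A F f ≠ 0 := by
    simp only [f, map_mul, map_prod]
    exact mul_ne_zero (mul_ne_zero hhp hyp) (Finset.prod_ne_zero_iff.mpr fun x _ ↦ hb x)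
  let A' := Localization.Away f
  let D := A' ⊗[A] D₀
  let ι : D₀ →ₐ[A] D := Algebra.TensorProduct.includeRight
  let mkD : B →ₐ[A] D := ι.comp (Ideal.Quotient.mkₐ A J)
  have hfu : IsUnit (algebraMap A A' f) := IsLocalization.Away.algebraMap_isUnit f
  have hbu (x : B) (hx : x ∈ s) : IsUnit (algebraMap A A' (b x)) :=
    isUnit_of_dvd_unit (map_dvd _ ((Finset.dvd_prod_of_mem b hx).mul_left _)) hfu
  have hyu : IsUnit (algebraMap A A' y) :=
    isUnit_of_dvd_unit (map_dvd _ ((dvd_mul_left y h).mul_right _)) hfu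
  have hhu : IsUnit (algebraMap A A' h) :=
    isUnit_of_dvd_unit (map_dvd _ ((dvd_mul_right h y).mul_right _)) hfu
  have htower (z : A) : algebraMap A D z = algebraMap A' D (algebraMap A A' z) :=
    IsScalarTower.algebraMap_apply A A' D z
  have hrelD (x : B) (hx : x ∈ s) : ∃ c : A', mkD x ^ q ^ e = algebraMap A' D c := by
    obtain ⟨u, hu⟩ := hbu x hx
    refine ⟨↑u⁻¹ * algebraMap A A' (a x), ?_⟩
    have h0 : mkD (algebraMap A B (b x) * x ^ q ^ e - algebraMap A B (a x)) = 0 := by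
      simp only [mkD, AlgHom.comp_apply]
      rw [show Ideal.Quotient.mkₐ A J _ = 0 from Ideal.Quotient.eq_zero_iff_mem.mpr
        (Ideal.subset_span (by simpa using ⟨x, hx, rfl⟩)), map_zero]
    rw [map_sub, map_mul, map_pow, AlgHom.commutes, AlgHom.commutes, sub_eq_zero, htower, htower,
      ← hu] at h0
    rw [map_mul, ← h0, ← mul_assoc, ← map_mul, Units.inv_mul, map_one, one_mul]
  -- `D` is generated over `A'` by the images of `s`.
  have hgen (P : Subalgebra A' D) (hP : ∀ x ∈ s, mkD x ∈ P) : P = ⊤ := by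
    have h1 : ∀ z : B, mkD z ∈ P := by
      have : Algebra.adjoin A (s : Set B) ≤ (P.restrictScalars A).comap mkD :=
        Algebra.adjoin_le hP
      rw [hs] at this
      exact fun z ↦ this (Algebra.mem_top (x := z))
    rw [eq_top_iff]
    rintro d -
    induction d using TensorProduct.induction_on with
    | zero => exact zero_mem _
    | add d₁ d₂ h₁ h₂ => exact add_mem h₁ h₂
    | tmul c z =>
      obtain ⟨z, rfl⟩ := Ideal.Quotient.mk_surjective z
      rw [show c ⊗ₜ[A] (Ideal.Quotient.mk J z) = c • mkD z by
        change _ = c • ((1 : A') ⊗ₜ[A] (Ideal.Quotient.mk J z))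
        rw [TensorProduct.smul_tmul', smul_eq_mul, mul_one]]
      exact P.smul_mem (h1 z) c
  refine ⟨f, hf, D, inferInstance, inferInstance, mkD, inferInstance, ?_, ?_, ?_, ?_, ?_⟩
  · have : Algebra.IsIntegral A' D := by
      rw [← integralClosure_eq_top_iff]
      refine hgen _ fun x hx ↦ ?_
      obtain ⟨c, hc⟩ := hrelD x hx
      refine IsIntegral.of_pow (n := q ^ e) (pow_pos (expChar_pos F q) _) ?_
      rw [hc]
      exact isIntegral_algebraMap
    exact Algebra.IsIntegral.finite
  -- Surjectivity: a prime `P` of `A'` lies under some `κ(Q)`-valued point of `D₀`, which extends to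
  -- the tensor product `D`; primes of the localization `A'` are determined by their traces on `A`.
  · intro P
    have hPh : PrimeSpectrum.comap (algebraMap A A') P ∈ PrimeSpectrum.basicOpen h := by
      intro hmem
      exact P.2.ne_top (Ideal.eq_top_of_isUnit_mem _ hmem hhu)
    obtain ⟨Q, hQ⟩ := hh hPh
    let κ := Q.asIdeal.ResidueField
    have hker (z : A) : algebraMap A κ z = 0 ↔ algebraMap A A' z ∈ P.asIdeal := by
      rw [IsScalarTower.algebraMap_apply A D₀ κ, Ideal.algebraMap_residueField_eq_zero]
      exact congr(z ∈ ($hQ).asIdeal).to_iff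
    have hfκ : IsUnit (algebraMap A κ f) := by
      rw [isUnit_iff_ne_zero, Ne, hker]
      exact fun hmem ↦ P.2.ne_top (Ideal.eq_top_of_isUnit_mem _ hmem hfu)
    let g : A' →ₐ[A] κ := IsLocalization.liftAlgHom (M := Submonoid.powers f)
      (f := Algebra.ofId A κ) (by
        rintro ⟨_, n, rfl⟩
        change IsUnit (algebraMap A κ (f ^ n))
        rw [map_pow]
        exact hfκ.pow n)
    let G : D →ₐ[A] κ := Algebra.TensorProduct.lift g (IsScalarTower.toAlgHom A D₀ κ)
      fun _ _ ↦ .all _ _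
    refine ⟨⟨RingHom.ker G.toRingHom, RingHom.ker_isPrime _⟩, ?_⟩
    apply PrimeSpectrum.localization_comap_injective A' (Submonoid.powers f)
    ext z
    change G (algebraMap A' D (algebraMap A A' z)) = 0 ↔ algebraMap A A' z ∈ P.asIdeal
    rw [← htower, AlgHom.commutes, hker]
  -- Two points with values in a field which agree on `A'` agree on the `q ^ e`-th powers of the
  -- generators, hence on the generators, because Frobenius is injective.
  · intro K _ g₁ g₂ hg
    let P : Subalgebra A' D :=
      { (g₁.eqLocus g₂) with
        algebraMap_mem' := fun r ↦ congr($hg r) }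
    have hP : P = ⊤ := by
      refine hgen P fun x hx ↦ ?_
      change g₁ (mkD x) = g₂ (mkD x)
      obtain ⟨c, hc⟩ := hrelD x hx
      have hpow : g₁ (mkD x) ^ q ^ e = g₂ (mkD x) ^ q ^ e := by
        rw [← map_pow g₁, ← map_pow g₂, hc]
        exact congr($hg c)
      rcases hy with hq | hy
      · simpa [hq] using hpow
      · have hq0 : (q : K) = 0 := by
          have h0 := ((hy.map (algebraMap A A')).map (algebraMap A' D)).map g₁
          simp only [map_mul, map_natCast] at h0
          exact (mul_eq_zero.mp h0.eq_zero).resolve_right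
            ((hyu.map (algebraMap A' D)).map g₁).ne_zero
        have hqp : q.Prime := (expChar_is_prime_or_one F q).resolve_right fun h1 ↦ by
          simp [h1] at hq0
        have : Fact q.Prime := ⟨hqp⟩
        have : CharP K q := (CharP.charP_iff_prime_eq_zero hqp).mpr hq0
        exact iterateFrobenius_inj K q e hpow
    refine RingHom.ext fun d ↦ ?_
    have : d ∈ P := by rw [hP]; exact Algebra.mem_top
    exact this
  · ext z
    exact (mkD.commutes z).trans (htower z)
  · intro he0
    have : (Algebra.ofId A' D).range = ⊤ := hgen _ fun x hx ↦ by
      obtain ⟨c, hc⟩ := hrelD x hx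
      rw [he0, pow_zero, pow_one] at hc
      exact ⟨c, hc.symm⟩
    intro d
    have hd : d ∈ (Algebra.ofId A' D).range := by rw [this]; exact Algebra.mem_top
    exact hd

/-! ### Étale-local lifting -/

open TensorProduct

/-- A nonzero smooth algebra over a separably closed field has a rational point: étale-locally it is
an affine space, over which étale morphisms have open image, and nonempty open subsets of affine
space have rational points since the field is infinite. -/
lemma exists_algHom_of_smooth_of_isSepClosed (K B : Type u) [Field K] [IsSepClosed K] [CommRing B]
    [Nontrivial B] [Algebra K B] [Algebra.Smooth K B] : Nonempty (B →ₐ[K] K) := by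
  obtain ⟨m, hm⟩ := Ideal.exists_maximal B
  -- A finite separably closed field would be perfect, hence algebraically closed, hence infinite.
  have : Infinite K := by
    by_contra h
    have : Finite K := not_infinite_iff_finite.mp h
    have : IsAlgClosed K := IsSepClosed.isAlgClosed_of_perfectField K
    exact h inferInstance
  have : Algebra.IsSmoothAt K m := inferInstance
  obtain ⟨f, hfm, n, _, _, _⟩ := Algebra.IsSmoothAt.exists_isStandardEtale_mvPolynomial
    (R := K) (p := m)
  set R := MvPolynomial (Fin n) K
  set C := Localization.Away f
  have : Algebra.Etale R C := inferInstance
  have hmap : IsUnit (algebraMap B (B ⧸ m) f) := by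
    let := Ideal.Quotient.field m
    rw [isUnit_iff_ne_zero]
    exact fun h ↦ hfm (Ideal.Quotient.eq_zero_iff_mem.mp h)
  have : Nontrivial C := (IsLocalization.Away.lift (S := C) f hmap).domain_nontrivial
  obtain ⟨P⟩ : Nonempty (PrimeSpectrum C) := inferInstance
  have hopen : IsOpen (Set.range (PrimeSpectrum.comap (algebraMap R C))) :=
    PrimeSpectrum.isOpenMap_comap_of_hasGoingDown_of_finitePresentation.isOpen_range
  obtain ⟨_, ⟨g, rfl⟩, hPg, hg⟩ :=
    PrimeSpectrum.isTopologicalBasis_basic_opens.exists_subset_of_mem_open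
      (Set.mem_range_self P) hopen
  have hg0 : g ≠ 0 := by
    rintro rfl
    simp at hPg
  obtain ⟨a, ha⟩ : ∃ a : Fin n → K, MvPolynomial.eval a g ≠ 0 := by
    by_contra! h
    exact hg0 (MvPolynomial.funext fun a ↦ by simpa using h a)
  let ev : R →ₐ[K] K := MvPolynomial.aeval a
  have hmem : (⟨RingHom.ker ev.toRingHom, RingHom.ker_isPrime _⟩ : PrimeSpectrum R) ∈
      PrimeSpectrum.basicOpen g := by
    change ¬ (MvPolynomial.aeval a g = 0)
    rwa [MvPolynomial.aeval_eq_eval]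
  obtain ⟨Q, hQ⟩ := hg hmem
  have hetale : Etale (Spec.map (CommRingCat.ofHom (algebraMap R C))) := by
    rw [HasRingHomProperty.Spec_iff (P := @Etale)]
    exact RingHom.etale_algebraMap.mpr inferInstance
  obtain ⟨l, hl, -⟩ := Scheme.exists_fac_of_etale_of_isSepClosed
    (Spec.map (CommRingCat.ofHom (algebraMap R C))) (Spec.map (CommRingCat.ofHom ev.toRingHom))
    Q (by
      refine Eq.trans hQ ?_
      have : (default : Spec (CommRingCat.of K)) = (⊥ : PrimeSpectrum K) := Subsingleton.elim _ _
      rw [this]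
      rfl)
  obtain ⟨ψ, rfl⟩ := Spec.map_surjective l
  rw [← Spec.map_comp, Spec.map_inj] at hl
  have hψ (x : R) : ψ.hom (algebraMap R C x) = ev x := congr($(hl).hom x)
  refine ⟨{ ψ.hom.comp (algebraMap B C) with commutes' := fun k ↦ ?_ }⟩
  change ψ.hom (algebraMap B C (algebraMap K B k)) = k
  rw [← IsScalarTower.algebraMap_apply K B C, IsScalarTower.algebraMap_apply K R C, hψ]
  exact ev.commutes k

lemma exists_algHom_separableClosure_of_smooth (K B : Type u) [Field K] [CommRing B]
    [Nontrivial B] [Algebra K B] [Algebra.Smooth K B] : Nonempty (B →ₐ[K] SeparableClosure K) := by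
  let F := SeparableClosure K
  have : Nontrivial (F ⊗[K] B) := inferInstance
  obtain ⟨θ⟩ := exists_algHom_of_smooth_of_isSepClosed F (F ⊗[K] B)
  exact ⟨(θ.restrictScalars K).comp Algebra.TensorProduct.includeRight⟩

/-- Étale-local lifting along a point `φ` of `Spec B` over a minimal prime `p` such that the
`q ^ e`-th powers of its coordinates are separable over `κ(p)`. An étale extension of `A` reduces
this to the case where they lie in `κ(p)`, treated in `exists_finite_radicial_surjective`. The last
clause serves the smooth case, where `e = 0`. -/
lemma exists_etale_finite_radicial_of_isSeparable_pow {A B F : Type u} [CommRing A] [CommRing B]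
    [Field F] [Algebra A B] [Algebra A F] [Algebra.FinitePresentation A B] (p : Ideal A) [p.IsPrime]
    (hp : p ∈ minimalPrimes A) [Algebra p.ResidueField F] [IsScalarTower A p.ResidueField F]
    (φ : B →ₐ[A] F) (s : Finset B) (hs : Algebra.adjoin A (s : Set B) = ⊤) (e : ℕ)
    (he : ∀ x ∈ s, IsSeparable p.ResidueField (φ x ^ ringExpChar F ^ e)) :
    ∃ (E : Type u) (_ : CommRing E) (_ : Algebra A E) (D : Type u) (_ : CommRing D)
      (_ : Algebra E D) (ψ : B →+* D), Algebra.Etale A E ∧ Nontrivial E ∧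
        Algebra.FinitePresentation E D ∧ Module.Finite E D ∧
        Function.Surjective (PrimeSpectrum.comap (algebraMap E D)) ∧
        (∀ (K : Type u) [Field K] (g₁ g₂ : D →+* K), g₁.comp (algebraMap E D) =
          g₂.comp (algebraMap E D) → g₁ = g₂) ∧
        ψ.comp (algebraMap A B) = (algebraMap E D).comp (algebraMap A E) ∧
        (e = 0 → Function.Surjective (algebraMap E D)) := by
  classical
  obtain ⟨A', _, _, _, χ, hχ⟩ := exists_etale_subset_closure_range p
    ((s.image fun x ↦ φ x ^ ringExpChar F ^ e : Finset F) : Set F) (Finset.finite_toSet _)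
    (by simpa using he)
  let := χ.toAlgebra
  have : IsScalarTower A A' F := .of_algebraMap_eq' χ.comp_algebraMap.symm
  have hker : (RingHom.ker (algebraMap A' F)).under A = p := by
    ext x
    rw [Ideal.under, Ideal.mem_comap, RingHom.mem_ker, ← IsScalarTower.algebraMap_apply A A' F,
      IsScalarTower.algebraMap_apply A p.ResidueField F, map_eq_zero,
      Ideal.algebraMap_residueField_eq_zero]
  have hp' : RingHom.ker (algebraMap A' F) ∈ minimalPrimes A' :=
    have : (RingHom.ker (algebraMap A' F)).IsPrime := RingHom.ker_isPrime _
    mem_minimalPrimes_of_under_mem_minimalPrimes (A := A) _ (hker ▸ hp)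
  let φ' : A' ⊗[A] B →ₐ[A'] F := Algebra.TensorProduct.lift (Algebra.ofId A' F) φ
    fun _ _ ↦ .all _ _
  let ι : B →ₐ[A] A' ⊗[A] B := Algebra.TensorProduct.includeRight
  obtain ⟨f, hf, D, _, _, ψ, h1, h2, h3, h4, h5, h6⟩ := exists_finite_radicial_surjective φ' hp'
    (s.image ι) (by
      rw [Finset.coe_image]
      exact Algebra.TensorProduct.adjoin_one_tmul_image_eq_top _ hs) e (by
      intro y hy
      obtain ⟨x, hx, rfl⟩ := Finset.mem_image.mp hy
      have : φ' (ι x) = φ x := by simp [φ', ι]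
      rw [this]
      exact hχ (by simpa using ⟨x, hx, rfl⟩))
  have : Nontrivial (Localization.Away f) :=
    (IsLocalization.Away.lift (S := Localization.Away f) f hf.isUnit).domain_nontrivial
  refine ⟨Localization.Away f, inferInstance, inferInstance, D, inferInstance, inferInstance,
    ψ.comp ι.toRingHom, ?_, this, h1, h2, h3, h4, ?_, h6⟩
  · exact Algebra.Etale.comp A A' _
  · have hι : ι.toRingHom.comp (algebraMap A B) =
        (algebraMap A' (A' ⊗[A] B)).comp (algebraMap A A') := by
      ext x
      exact (ι.commutes x).trans (IsScalarTower.algebraMap_apply A A' _ x)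
    rw [RingHom.comp_assoc, hι, ← RingHom.comp_assoc, h5, RingHom.comp_assoc,
      ← IsScalarTower.algebraMap_eq]

/-- Over an étale neighbourhood of a minimal prime, a finitely presented algebra with nonempty
fibre there acquires a point after a finite surjective radicial extension. The latter is described
by injectivity on points with values in fields. -/
theorem exists_etale_finite_radicial {A B : Type u} [CommRing A] [CommRing B]
    [Algebra A B] [Algebra.FinitePresentation A B] (p : PrimeSpectrum A)
    (hp : p.asIdeal ∈ minimalPrimes A)
    (hpB : p ∈ Set.range (PrimeSpectrum.comap (algebraMap A B))) :
    ∃ (E : Type u) (_ : CommRing E) (_ : Algebra A E) (D : Type u) (_ : CommRing D)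
      (_ : Algebra E D) (ψ : B →+* D), Algebra.Etale A E ∧ Nontrivial E ∧ Module.Finite E D ∧
        Function.Surjective (PrimeSpectrum.comap (algebraMap E D)) ∧
        (∀ (K : Type u) [Field K] (g₁ g₂ : D →+* K), g₁.comp (algebraMap E D) =
          g₂.comp (algebraMap E D) → g₁ = g₂) ∧
        ψ.comp (algebraMap A B) = (algebraMap E D).comp (algebraMap A E) := by
  classical
  let k := p.asIdeal.ResidueField
  have : Nontrivial (k ⊗[A] B) := (PrimeSpectrum.nontrivial_iff_mem_rangeComap p).mpr hpB
  -- A closed point of the fibre has finite residue extension by the Nullstellensatz.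
  obtain ⟨m, hm⟩ := Ideal.exists_maximal (k ⊗[A] B)
  let F := (k ⊗[A] B) ⧸ m
  let : Field F := Ideal.Quotient.field m
  have : Module.Finite k F := finite_of_finite_type_of_isJacobsonRing k F
  let φ : B →ₐ[A] F := (Ideal.Quotient.mkₐ A m).comp Algebra.TensorProduct.includeRight
  obtain ⟨s, hs⟩ := (inferInstance : Algebra.FiniteType A B).out
  have : ExpChar k (ringExpChar F) :=
    (algebraMap k F).expChar (algebraMap k F).injective _
  -- `F` is purely inseparable over the separable closure of `k` in it.
  have hsep (x : B) : ∃ n, IsSeparable k (φ x ^ ringExpChar F ^ n) := by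
    have : IsPurelyInseparable (separableClosure k F) F := separableClosure.isPurelyInseparable k F
    have : ExpChar (separableClosure k F) (ringExpChar F) :=
      (algebraMap (separableClosure k F) F).expChar
        (algebraMap (separableClosure k F) F).injective _
    obtain ⟨n, y, hy⟩ := IsPurelyInseparable.pow_mem (separableClosure k F) (ringExpChar F) (φ x)
    exact ⟨n, hy ▸ mem_separableClosure_iff.mp y.2⟩
  choose n hn using hsep
  obtain ⟨E, i1, i2, D, i3, i4, ψ, h1, h2, -, h3, h4, h5, h6, -⟩ :=
    exists_etale_finite_radicial_of_isSeparable_pow p.asIdeal hp φ s hs (s.sup n) (fun x hx ↦ by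
      obtain ⟨d, hd⟩ := Nat.exists_eq_add_of_le (Finset.le_sup (f := n) hx)
      rw [hd, pow_add, pow_mul]
      exact mem_separableClosure_iff.mp (pow_mem (mem_separableClosure_iff.mpr (hn x)) _))
  exact ⟨E, i1, i2, D, i3, i4, ψ, h1, h2, h3, h4, h5, h6⟩

/-- Over an étale neighbourhood of a minimal prime, a smooth algebra with nonempty fibre there
acquires a point. -/
theorem exists_etale_algHom_of_smooth {A B : Type u} [CommRing A] [CommRing B]
    [Algebra A B] [Algebra.Smooth A B] (p : PrimeSpectrum A)
    (hp : p.asIdeal ∈ minimalPrimes A)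
    (hpB : p ∈ Set.range (PrimeSpectrum.comap (algebraMap A B))) :
    ∃ (E : Type u) (_ : CommRing E) (_ : Algebra A E), Algebra.Etale A E ∧ Nontrivial E ∧
      Nonempty (B →ₐ[A] E) := by
  classical
  let k := p.asIdeal.ResidueField
  have : Nontrivial (k ⊗[A] B) := (PrimeSpectrum.nontrivial_iff_mem_rangeComap p).mpr hpB
  let F := SeparableClosure k
  obtain ⟨θ⟩ := exists_algHom_separableClosure_of_smooth k (k ⊗[A] B)
  let φ : B →ₐ[A] F := (θ.restrictScalars A).comp Algebra.TensorProduct.includeRight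
  obtain ⟨s, hs⟩ := (inferInstance : Algebra.FiniteType A B).out
  obtain ⟨E, i1, i2, D, i3, i4, ψ, h1, h2, hfp, -, h3, -, h5, h6⟩ :=
    exists_etale_finite_radicial_of_isSeparable_pow p.asIdeal hp φ s hs 0 (fun x hx ↦
      Algebra.IsSeparable.isSeparable k _)
  let : Algebra A D := ((algebraMap E D).comp (algebraMap A E)).toAlgebra
  have : IsScalarTower A E D := .of_algebraMap_eq' rfl
  -- For `e = 0`, `E → D` is surjective with nilpotent kernel, so the point lifts from `D` to `E`.
  have hsurj := h6 rfl
  have hker : IsNilpotent (RingHom.ker (IsScalarTower.toAlgHom A E D : E →+* D)) := by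
    refine (Ideal.FG.isNilpotent_iff_le_nilradical ?_).mpr ?_
    · exact Algebra.FinitePresentation.ker_fG_of_surjective (Algebra.ofId E D) hsurj
    · exact (PrimeSpectrum.denseRange_comap_iff_ker_le_nilRadical _).mp h3.denseRange
  let ψ' : B →ₐ[A] D := { ψ with commutes' := fun a ↦ congr($h5 a) }
  exact ⟨E, i1, i2, h1, h2, ⟨Algebra.FormallySmooth.liftOfSurjective ψ'
    (IsScalarTower.toAlgHom A E D) hsurj hker⟩⟩

/-! ### Points with purely inseparable or trivial residue extension -/

lemma RingHom.IsPurelyInseparable.of_comp_right {F E K : Type*} [Field F] [Field E] [Field K]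
    {f : F →+* E} {g : E →+* K} (h : (g.comp f).IsPurelyInseparable) : g.IsPurelyInseparable := by
  algebraize [f, g, g.comp f]
  exact IsPurelyInseparable.tower_top F E K

lemma RingHom.IsPurelyInseparable.of_comp_left {F E K : Type*} [Field F] [Field E] [Field K]
    {f : F →+* E} {g : E →+* K} (h : (g.comp f).IsPurelyInseparable) : f.IsPurelyInseparable := by
  algebraize [f, g, g.comp f]
  exact IsPurelyInseparable.tower_bot F E K

namespace QuasiLifting

section ResiduePoints

variable {X Y Z : Scheme.{u}} {f : X ⟶ Y} {g : Y ⟶ Z} {x : X}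

lemma mem_QRelSource_of_comp (h : x ∈ QRelSource (f ≫ g)) : x ∈ QRelSource f := by
  change ((f ≫ g).residueFieldMap x).hom.IsPurelyInseparable at h
  rw [Scheme.residueFieldMap_comp] at h
  exact h.of_comp_right

lemma map_mem_QRelSource_of_comp (h : x ∈ QRelSource (f ≫ g)) : f x ∈ QRelSource g := by
  change ((f ≫ g).residueFieldMap x).hom.IsPurelyInseparable at h
  rw [Scheme.residueFieldMap_comp] at h
  exact h.of_comp_left

lemma mem_QRelSource_comp (hf : x ∈ QRelSource f) (hg : f x ∈ QRelSource g) :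
    x ∈ QRelSource (f ≫ g) := by
  change ((f ≫ g).residueFieldMap x).hom.IsPurelyInseparable
  rw [Scheme.residueFieldMap_comp]
  exact RingHom.IsPurelyInseparable.comp hg hf

lemma mem_QRelSource_of_universallyInjective (f : X ⟶ Y) [UniversallyInjective f] (x : X) :
    x ∈ QRelSource f :=
  have h : Function.Injective f ∧ ∀ x, (f.residueFieldMap x).hom.IsPurelyInseparable :=
    ((tfae_universallyInjective f).out 0 2).mp ‹UniversallyInjective f›
  h.2 x

lemma map_mem_RelSource_of_comp (h : x ∈ RelSource (f ≫ g)) : f x ∈ RelSource g := by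
  change Function.Bijective ((f ≫ g).residueFieldMap x).hom at h
  rw [Scheme.residueFieldMap_comp] at h
  refine ⟨RingHom.injective _, fun y ↦ ?_⟩
  obtain ⟨z, hz⟩ := h.2 ((f.residueFieldMap x).hom y)
  exact ⟨z, (f.residueFieldMap x).hom.injective hz⟩

lemma mem_RelSource_of_surjectiveOnStalks (f : X ⟶ Y) [SurjectiveOnStalks f] (x : X) :
    x ∈ RelSource f := by
  refine ⟨RingHom.injective _, fun y ↦ ?_⟩
  obtain ⟨y, rfl⟩ := X.residue_surjective x y
  obtain ⟨z, rfl⟩ := f.stalkMap_surjective x y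
  exact ⟨Y.residue _ z, congr($(Scheme.residue_residueFieldMap f x).hom z)⟩

/-- A purely inseparable residue extension of an étale morphism is trivial. -/
lemma mem_RelSource_of_etale [Etale f] (h : x ∈ QRelSource f) : x ∈ RelSource f := by
  let := (f.residueFieldMap x).hom.toAlgebra
  have : Algebra.IsSeparable (Y.residueField (f x)) (X.residueField x) := inferInstance
  have : IsPurelyInseparable (Y.residueField (f x)) (X.residueField x) := h
  exact ⟨RingHom.injective _, IsPurelyInseparable.surjective_algebraMap_of_isSeparable _ _⟩

end ResiduePoints

/-- A nonzero étale algebra over an affine open subscheme of a Poonen scheme has a point with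
trivial residue extension. -/
lemma IsPoonenScheme.exists_algHom_residueField {S : Scheme.{u}} (hS : IsPoonenScheme S)
    {R : Type u} [CommRing R] (i : Spec (.of R) ⟶ S) [IsOpenImmersion i]
    (E : Type u) [CommRing E] [Nontrivial E] [Algebra R E] [Algebra.Etale R E] :
    ∃ (q : Ideal R) (_ : q.IsPrime), Nonempty (E →ₐ[R] q.ResidueField) := by
  let φ : CommRingCat.of R ⟶ CommRingCat.of E := CommRingCat.ofHom (algebraMap R E)
  have : Etale (Spec.map φ) := by
    rw [HasRingHomProperty.Spec_iff (P := @Etale)]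
    exact RingHom.etale_algebraMap.mpr inferInstance
  let g := Spec.map φ ≫ i
  let U : S.Opens := ⟨Set.range g, g.isOpenMap.isOpen_range⟩
  let h : Spec (.of E) ⟶ U := IsOpenImmersion.lift U.ι g (by simp [U])
  have hh : h ≫ U.ι = g := IsOpenImmersion.lift_fac _ _ _
  have hsurj : Surjective h := by
    refine ⟨fun u ↦ ?_⟩
    obtain ⟨x, hx⟩ := u.2
    refine ⟨x, U.ι.injective ?_⟩
    rw [← Scheme.Hom.comp_apply, hh]
    exact hx
  -- `U` is open in the affine scheme `Spec R`, hence quasi-separated, which makes `h`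
  -- quasi-compact.
  have : QuasiSeparatedSpace U := by
    let l : U.toScheme ⟶ Spec (.of R) := IsOpenImmersion.lift i U.ι (by
      rw [Scheme.Opens.range_ι]
      rintro _ ⟨x, rfl⟩
      exact ⟨Spec.map φ x, rfl⟩)
    have hl : l ≫ i = U.ι := IsOpenImmersion.lift_fac _ _ _
    have : IsOpenImmersion l := by
      have : IsOpenImmersion (l ≫ i) := hl ▸ inferInstance
      exact IsOpenImmersion.of_comp l i
    exact quasiSeparatedSpace_of_quasiSeparated l
  have : Etale (h ≫ U.ι) := hh ▸ inferInstance
  have : Etale h := Etale.of_comp h U.ι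
  have hfp : IsOfFinitePresentation h :=
    ⟨inferInstance, inferInstance, inferInstance⟩
  have hU : (U : Set S).Nonempty := by
    obtain ⟨P⟩ : Nonempty (Spec (.of E)) := inferInstance
    exact ⟨_, P, rfl⟩
  obtain ⟨_, Q, hQ, -⟩ := hS U hU _ h hfp inferInstance
  -- The given point is purely inseparable over `U`, hence over `Spec R`.
  have hQ' : Q ∈ RelSource (Spec.map φ) := by
    refine mem_RelSource_of_etale (mem_QRelSource_of_comp (g := i) ?_)
    rw [show Spec.map φ ≫ i = h ≫ U.ι from hh.symm]
    exact mem_QRelSource_comp hQ (mem_QRelSource_of_universallyInjective _ _)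
  have hiso : IsIso ((Spec.map φ).residueFieldMap Q) :=
    (ConcreteCategory.isIso_iff_bijective _).mpr hQ'
  let q : PrimeSpectrum R := Spec.map φ Q
  -- The `κ(q)`-valued point of `Spec E` given by `Q` and the isomorphism `κ(q) ≅ κ(Q)`.
  let s : Spec (.of q.asIdeal.ResidueField) ⟶ Spec (.of E) :=
    Spec.map (Scheme.Spec.residueFieldIso (.of R) q).hom ≫
      Spec.map (inv ((Spec.map φ).residueFieldMap Q)) ≫ (Spec (.of E)).fromSpecResidueField Q
  have hs : s ≫ Spec.map φ =
      Spec.map (CommRingCat.ofHom (algebraMap R q.asIdeal.ResidueField)) := by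
    have h1 : Spec.map (inv ((Spec.map φ).residueFieldMap Q)) ≫
        (Spec (.of E)).fromSpecResidueField Q ≫ Spec.map φ =
          (Spec (.of R)).fromSpecResidueField (Spec.map φ Q) := by
      rw [← Scheme.Hom.SpecMap_residueFieldMap_fromSpecResidueField, ← Spec.map_comp_assoc,
        IsIso.hom_inv_id, Spec.map_id, Category.id_comp]
    have h2 := h1.trans
      (Scheme.Spec.map_residueFieldIso_inv_eq_fromSpecResidueField (.of R) (Spec.map φ Q)).symm
    have h3 := congr_arg
      (Spec.map (Scheme.Spec.residueFieldIso (.of R) (Spec.map φ Q)).hom ≫ ·) h2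
    simp only [← Spec.map_comp_assoc, Iso.inv_hom_id, Spec.map_id, Category.id_comp] at h3
    simp only [s, ← Spec.map_comp_assoc, Category.assoc]
    exact h3
  obtain ⟨θ, hθ⟩ := Spec.map_surjective s
  rw [← hθ, ← Spec.map_comp, Spec.map_inj] at hs
  exact ⟨q.asIdeal, q.2, ⟨{ θ.hom with commutes' := fun r ↦ congr($(hs).hom r) }⟩⟩

end QuasiLifting

/-- A point of an étale `R`-algebra `E` with trivial residue extension extends to a section of
`Spec E` over the zero locus of one function `c` on an open subscheme `Spec R'` of `Spec R`; this
locus is nonempty since `c` is not a unit. -/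
lemma exists_localization_lift_of_etale {R E : Type u} [CommRing R] [CommRing E] [Algebra R E]
    [Algebra.Etale R E] (q : Ideal R) [q.IsPrime] (χ : E →ₐ[R] q.ResidueField) :
    ∃ (R' : Type u) (_ : CommRing R') (_ : Algebra R R') (c : R'),
      IsOpenImmersion (Spec.map (CommRingCat.ofHom (algebraMap R R'))) ∧ ¬ IsUnit c ∧
      Nonempty (E →ₐ[R] R' ⧸ Ideal.span {c}) := by
  let Q : Ideal E := RingHom.ker χ
  have : Q.IsPrime := RingHom.ker_isPrime _
  obtain ⟨f, hfQ, hf⟩ := Algebra.IsEtaleAt.exists_isStandardEtale (R := R) Q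
  let C := Localization.Away f
  obtain ⟨P⟩ : Nonempty (StandardEtalePresentation R C) := inferInstance
  have hχf : IsUnit (χ f) := isUnit_iff_ne_zero.mpr hfQ
  let χ' : C →ₐ[R] q.ResidueField := IsLocalization.liftAlgHom (M := Submonoid.powers f)
    (f := χ) (by
      rintro ⟨_, n, rfl⟩
      rw [map_pow]
      exact hχf.pow n)
  -- The value at the point of the generator of the standard étale algebra `C`, as a fraction.
  obtain ⟨a, b, hb, hab⟩ := IsFractionRing.div_surjective (A := R ⧸ q) (χ' P.x)
  obtain ⟨a, rfl⟩ := Ideal.Quotient.mk_surjective a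
  obtain ⟨b, rfl⟩ := Ideal.Quotient.mk_surjective b
  have hb' : algebraMap R q.ResidueField b ≠ 0 := by
    rw [Ne, Ideal.algebraMap_residueField_eq_zero]
    intro h
    exact nonZeroDivisors.ne_zero hb (Ideal.Quotient.eq_zero_iff_mem.mpr h)
  replace hab : algebraMap R q.ResidueField a = algebraMap R q.ResidueField b * χ' P.x := by
    rw [← hab]
    exact (mul_div_cancel₀ _ hb').symm
  let R₁ := Localization.Away b
  let l₁ : R₁ →ₐ[R] q.ResidueField := IsLocalization.liftAlgHom (M := Submonoid.powers b)
    (f := Algebra.ofId R _) (by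
      rintro ⟨_, n, rfl⟩
      rw [map_pow]
      exact hb'.isUnit.pow n)
  let t : R₁ := IsLocalization.Away.invSelf b * algebraMap R R₁ a
  have ht : l₁ t = χ' P.x := by
    have h1 : algebraMap R _ b * l₁ (IsLocalization.Away.invSelf b) = 1 := by
      rw [← l₁.commutes, ← map_mul, IsLocalization.Away.mul_invSelf, map_one]
    rw [map_mul, l₁.commutes, hab, mul_left_comm, ← mul_assoc, h1, one_mul]
  -- `R₂` is obtained by inverting `b` and then `g (a / b)`, and `c = f (a / b)`. Both `l₁` and `l₂`
  -- are evaluation at `q`, where `c` vanishes.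
  let g₁ : R₁ := Polynomial.aeval t P.P.g
  have hg₁ : l₁ g₁ ≠ 0 := by
    rw [← Polynomial.aeval_algHom_apply, ht, Polynomial.aeval_algHom_apply]
    exact (P.hasMap.2.map χ').ne_zero
  let R₂ := Localization.Away g₁
  let l₂ : R₂ →+* q.ResidueField := IsLocalization.Away.lift g₁ (g := l₁.toRingHom) hg₁.isUnit
  let t₂ : R₂ := algebraMap R₁ R₂ t
  let c : R₂ := Polynomial.aeval t₂ P.P.f
  let k := Ideal.Quotient.mkₐ R (Ideal.span {c})
  have hmap : P.P.HasMap (k t₂) := by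
    constructor
    · rw [Polynomial.aeval_algHom_apply]
      exact Ideal.Quotient.eq_zero_iff_mem.mpr (Ideal.mem_span_singleton_self c)
    · rw [Polynomial.aeval_algHom_apply, Polynomial.aeval_algebraMap_apply]
      exact (IsLocalization.Away.algebraMap_isUnit g₁).map k
  refine ⟨R₂, inferInstance, inferInstance, c, ?_, fun hc ↦ ?_, ⟨((P.P.lift _ hmap).comp
    P.equivRing.toAlgHom).comp (IsScalarTower.toAlgHom R E C)⟩⟩
  · rw [IsScalarTower.algebraMap_eq R R₁ R₂, CommRingCat.ofHom_comp, Spec.map_comp]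
    infer_instance
  · have : l₂ c = 0 := by
      change l₂ (Polynomial.aeval (algebraMap R₁ R₂ t) P.P.f) = 0
      rw [Polynomial.aeval_algebraMap_apply]
      refine (IsLocalization.Away.lift_eq g₁ hg₁.isUnit _).trans ?_
      change l₁ _ = 0
      rw [← Polynomial.aeval_algHom_apply, ht, Polynomial.aeval_algHom_apply, P.hasMap.1, map_zero]
    exact (hc.map l₂).ne_zero this

/-! ### Lifting to a principal subscheme -/

namespace QuasiLifting

open Limits

/-- An affine chart of `f` with a point over a generic point of `S`. -/
lemma exists_affine_chart_over_minimalPrime {X S : Scheme.{u}} [Nonempty S] (f : X ⟶ S)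
    [LocallyOfFinitePresentation f] [QuasiCompact f] [IsDominant f] :
    ∃ (A B : Type u) (_ : CommRing A) (_ : CommRing B) (_ : Algebra A B)
      (i : Spec (.of A) ⟶ S) (j : Spec (.of B) ⟶ X) (p : PrimeSpectrum A),
      IsOpenImmersion i ∧ j ≫ f = Spec.map (CommRingCat.ofHom (algebraMap A B)) ≫ i ∧
      Algebra.FinitePresentation A B ∧ p.asIdeal ∈ minimalPrimes A ∧
      p ∈ Set.range (PrimeSpectrum.comap (algebraMap A B)) ∧
      (Smooth f → Algebra.Smooth A B) := by
  obtain ⟨A, i, _, s, -⟩ := S.exists_Spec_apply_eq (Classical.arbitrary S)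
  let Y : Scheme.{u} := pullback f i
  let g : Y ⟶ Spec A := pullback.snd f i
  have hg : IsDominant g := IsZariskiLocalAtTarget.of_isPullback (P := @IsDominant)
    (.of_hasPullback f i) inferInstance
  have : CompactSpace Y := inferInstanceAs (CompactSpace ↑(pullback f i))
  obtain ⟨C, π, hπ⟩ := compactSpace_iff_exists.mp this
  obtain ⟨φ, hφ⟩ := Spec.map_surjective (π ≫ g)
  -- A dense image of an affine scheme contains the minimal primes.
  have hdense : DenseRange (PrimeSpectrum.comap φ.hom) := by
    have : DenseRange (π ≫ g) := by
      rw [Scheme.Hom.comp_base, TopCat.coe_comp]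
      exact g.denseRange.comp hπ.denseRange g.continuous
    rw [← hφ] at this
    exact this
  have : Nontrivial A := PrimeSpectrum.nontrivial (s : PrimeSpectrum A)
  obtain ⟨P, hP⟩ := Ideal.nonempty_minimalPrimes (bot_ne_top : (⊥ : Ideal A) ≠ ⊤)
  obtain ⟨z, hz⟩ := (PrimeSpectrum.denseRange_comap_iff_minimalPrimes φ.hom).mp hdense P hP
  let w : Spec C := z
  have hw : g (π w) = (⟨P, hP.1.1⟩ : PrimeSpectrum A) :=
    (congr($hφ w) : Spec.map φ w = (π ≫ g) w).symm.trans hz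
  obtain ⟨B, k, _, y, hy⟩ := Y.exists_Spec_apply_eq (π w)
  obtain ⟨θ, hθ⟩ := Spec.map_surjective (k ≫ g)
  have hfp : LocallyOfFinitePresentation (Spec.map θ) := by
    rw [hθ]
    infer_instance
  refine ⟨A, B, inferInstance, inferInstance, θ.hom.toAlgebra, i, k ≫ pullback.fst f i,
    ⟨P, hP.1.1⟩, ‹_›, ?_, HasRingHomProperty.Spec_iff.mp hfp, hP, ⟨y, ?_⟩, fun hf ↦ ?_⟩
  · change _ = Spec.map θ ≫ i
    rw [hθ, Category.assoc, Category.assoc, pullback.condition]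
  · exact (congr($hθ y) : Spec.map θ y = g (k y)).trans ((congr_arg g hy).trans hw)
  · have : Smooth (Spec.map θ) := by
      rw [hθ]
      infer_instance
    exact HasRingHomProperty.Spec_iff.mp this

lemma isClosedImmersionByOneEquation_quotient {R : Type u} [CommRing R] (c : R) :
    IsClosedImmersionByOneEquation
      (Spec.map (CommRingCat.ofHom (Ideal.Quotient.mk (Ideal.span {c})))) := by
  have hcl : IsClosedImmersion
      (Spec.map (CommRingCat.ofHom (Ideal.Quotient.mk (Ideal.span {c})))) :=
    IsClosedImmersion.spec_of_surjective _ Ideal.Quotient.mk_surjective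
  refine ⟨hcl, fun x ↦ ⟨⟨⊤, isAffineOpen_top _⟩, trivial, ?_⟩⟩
  rw [Scheme.Hom.ker_apply]
  refine ⟨⟨(Scheme.ΓSpecIso (.of R)).inv c, ?_⟩⟩
  have h := Scheme.ΓSpecIso_inv_naturality
    (CommRingCat.ofHom (Ideal.Quotient.mk (Ideal.span {c})))
  ext x
  obtain ⟨r, rfl⟩ := (ConcreteCategory.bijective_of_isIso (Scheme.ΓSpecIso (.of R)).inv).2 x
  have hr : (Spec.map (CommRingCat.ofHom (Ideal.Quotient.mk (Ideal.span {c})))).appTop.hom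
      ((Scheme.ΓSpecIso (.of R)).inv r) =
      (Scheme.ΓSpecIso (.of (R ⧸ Ideal.span {c}))).inv (Ideal.Quotient.mk _ r) :=
    congr($(h.symm).hom r)
  have hr₀ : r ∈ Ideal.span {c} ↔
      (Scheme.ΓSpecIso (.of (R ⧸ Ideal.span {c}))).inv (Ideal.Quotient.mk _ r) = 0 := by
    rw [← Ideal.Quotient.eq_zero_iff_mem]
    exact (map_eq_zero_iff (Scheme.ΓSpecIso (.of (R ⧸ Ideal.span {c}))).inv.hom
      (ConcreteCategory.bijective_of_isIso _).1).symm
  refine (RingHom.mem_ker (f := (Scheme.Hom.appTop _).hom)).trans ?_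
  rw [hr, ← hr₀]
  change _ ↔ (Scheme.ΓSpecIso (.of R)).inv r ∈ Ideal.span _
  rw [Ideal.mem_span_singleton, Ideal.mem_span_singleton]
  exact (map_dvd_iff (Scheme.ΓSpecIso (.of R)).symm.commRingCatIsoToRingEquiv).symm

lemma universallyInjective_of_ringHom_ext {R A : Type u} [CommRing R] [CommRing A] (φ : R →+* A)
    (h : ∀ (K : Type u) [Field K] (g₁ g₂ : A →+* K), g₁.comp φ = g₂.comp φ → g₁ = g₂) :
    UniversallyInjective (Spec.map (CommRingCat.ofHom φ)) := by
  refine ((tfae_universallyInjective _).out 0 1 :).mpr fun K _ g₁ g₂ hg ↦ ?_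
  obtain ⟨g₁, rfl⟩ := Spec.map_surjective g₁
  obtain ⟨g₂, rfl⟩ := Spec.map_surjective g₂
  simp only [← Spec.map_comp] at hg
  congr 1
  ext1
  exact h K _ _ congr($(Spec.map_injective hg).hom)

lemma IsLiftable.isQuasiLiftable {X S T : Scheme.{u}} {f : X ⟶ S} {i : T ⟶ S}
    (h : IsLiftable f i) : IsQuasiLiftable f i := by
  obtain ⟨j, hj⟩ := h
  exact ⟨T, 𝟙 T, j, inferInstance, inferInstance, inferInstance, by simpa using hj⟩

lemma IsQuasiLiftable.mem_QRel {X S T : Scheme.{u}} {f : X ⟶ S} {i : T ⟶ S} [Mono i]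
    (h : IsQuasiLiftable f i) (t : T) : i t ∈ QRel f := by
  obtain ⟨T', ρ, j, _, _, _, hj⟩ := h
  obtain ⟨t', rfl⟩ := ρ.surjective t
  refine ⟨j t', map_mem_QRelSource_of_comp (f := j) ?_, ?_⟩
  · have : UniversallyInjective (ρ ≫ i) :=
      MorphismProperty.comp_mem _ _ _ ‹_› inferInstance
    rw [hj]
    exact mem_QRelSource_of_universallyInjective _ _
  · rw [← Scheme.Hom.comp_apply, hj, Scheme.Hom.comp_apply]

lemma IsLiftable.mem_Rel {X S T : Scheme.{u}} {f : X ⟶ S} {i : T ⟶ S} [SurjectiveOnStalks i]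
    (h : IsLiftable f i) (t : T) : i t ∈ Rel f := by
  obtain ⟨j, rfl⟩ := h
  exact ⟨j t, map_mem_RelSource_of_comp (mem_RelSource_of_surjectiveOnStalks _ _), by simp⟩

/-- The principal subscheme that is quasi-liftable, and liftable in the smooth case, can be taken to
be the zero locus of a non-unit `c` on an affine open subscheme `Spec R`. -/
lemma IsPoonenScheme.exists_isQuasiLiftable {S : Scheme.{u}} [Nonempty S] (hS : IsPoonenScheme S)
    {X : Scheme.{u}} (f : X ⟶ S) [LocallyOfFinitePresentation f] [QuasiCompact f] [IsDominant f] :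
    ∃ (R : Type u) (_ : CommRing R) (c : R) (i : Spec (.of R) ⟶ S), IsOpenImmersion i ∧
      ¬ IsUnit c ∧
      IsQuasiLiftable f
        (Spec.map (CommRingCat.ofHom (Ideal.Quotient.mk (Ideal.span {c}))) ≫ i) ∧
      (Smooth f → IsLiftable f
        (Spec.map (CommRingCat.ofHom (Ideal.Quotient.mk (Ideal.span {c}))) ≫ i)) := by
  obtain ⟨A, B, _, _, _, i, j, p, _, hij, _, hp, hpB, hsm⟩ :=
    exists_affine_chart_over_minimalPrime f
  by_cases hf : Smooth f
  · have := hsm hf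
    obtain ⟨E, _, _, _, _, ⟨ψ⟩⟩ := exists_etale_algHom_of_smooth (B := B) p hp hpB
    obtain ⟨q, _, ⟨χ⟩⟩ := hS.exists_algHom_residueField i E
    obtain ⟨R, _, _, c, _, hc, ⟨χ'⟩⟩ := exists_localization_lift_of_etale q χ
    have h : IsLiftable f (Spec.map (CommRingCat.ofHom (Ideal.Quotient.mk (Ideal.span {c}))) ≫
        Spec.map (CommRingCat.ofHom (algebraMap A R)) ≫ i) := by
      refine ⟨Spec.map (CommRingCat.ofHom (χ'.comp ψ).toRingHom) ≫ j, ?_⟩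
      rw [Category.assoc, hij, ← Spec.map_comp_assoc, ← Spec.map_comp_assoc,
        ← CommRingCat.ofHom_comp, ← CommRingCat.ofHom_comp]
      congr 3
      exact (χ'.comp ψ).comp_algebraMap
    exact ⟨R, _, c, Spec.map (CommRingCat.ofHom (algebraMap A R)) ≫ i, inferInstance, hc,
      h.isQuasiLiftable, fun _ ↦ h⟩
  · obtain ⟨E, _, _, D, _, _, ψ, _, _, _, hsurj, hinj, hψ⟩ :=
      exists_etale_finite_radicial (B := B) p hp hpB
    obtain ⟨q, _, ⟨χ⟩⟩ := hS.exists_algHom_residueField i E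
    obtain ⟨R, _, _, c, _, hc, ⟨χ'⟩⟩ := exists_localization_lift_of_etale q χ
    let ρ : Spec (.of D) ⟶ Spec (.of E) := Spec.map (CommRingCat.ofHom (algebraMap E D))
    have hfin : IsFinite ρ :=
      (IsFinite.SpecMap_iff _).mpr (RingHom.finite_algebraMap.mpr inferInstance)
    have hρ : Surjective ρ := ⟨hsurj⟩
    have hui : UniversallyInjective ρ := universallyInjective_of_ringHom_ext _ hinj
    let t : Spec (.of (R ⧸ Ideal.span {c})) ⟶ Spec (.of E) :=
      Spec.map (CommRingCat.ofHom χ'.toRingHom)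
    -- The cover `ρ` of `Spec E`, pulled back along the section `t`.
    refine ⟨R, _, c, Spec.map (CommRingCat.ofHom (algebraMap A R)) ≫ i, inferInstance, hc,
      ⟨pullback t ρ, pullback.fst t ρ,
        pullback.snd t ρ ≫ Spec.map (CommRingCat.ofHom ψ) ≫ j, inferInstance, inferInstance,
        UniversallyInjective.isStableUnderBaseChange.of_isPullback
          (IsPullback.of_hasPullback t ρ).flip hui, ?_⟩, fun h ↦ absurd h hf⟩
    have h₁ : Spec.map (CommRingCat.ofHom ψ) ≫ j ≫ f =
        ρ ≫ Spec.map (CommRingCat.ofHom (algebraMap A E)) ≫ i := by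
      rw [hij, ← Spec.map_comp_assoc, ← Spec.map_comp_assoc,
        ← CommRingCat.ofHom_comp, ← CommRingCat.ofHom_comp, hψ]
    have h₂ : t ≫ Spec.map (CommRingCat.ofHom (algebraMap A E)) =
        Spec.map (CommRingCat.ofHom (Ideal.Quotient.mk (Ideal.span {c}))) ≫
          Spec.map (CommRingCat.ofHom (algebraMap A R)) := by
      rw [← Spec.map_comp, ← Spec.map_comp, ← CommRingCat.ofHom_comp, ← CommRingCat.ofHom_comp]
      congr 2
      exact χ'.comp_algebraMap
    rw [Category.assoc, Category.assoc, h₁, ← pullback.condition_assoc, reassoc_of% h₂]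

lemma ringKrullDim_stalk_of_isOpenImmersion {R : Type u} [CommRing R] {S : Scheme.{u}}
    (i : Spec (.of R) ⟶ S) [IsOpenImmersion i] (P : PrimeSpectrum R) :
    ringKrullDim (S.presheaf.stalk (i P)) = P.asIdeal.height := by
  let x : Spec (.of R) := P
  let e := ((asIso (i.stalkMap x)) ≪≫ Spec.stalkIso (.of R) x).commRingCatIsoToRingEquiv
  exact (ringKrullDim_eq_of_ringEquiv e).trans
    (IsLocalization.AtPrime.ringKrullDim_eq_height P.asIdeal (Localization.AtPrime P.asIdeal))

/-- By Krull's principal ideal theorem, the zero locus of a non-unit of a noetherian ring contains a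
prime of height at most one. -/
lemma exists_mem_range_height_le_one {R : Type u} [CommRing R] [IsNoetherianRing R] {c : R}
    (hc : ¬ IsUnit c) :
    ∃ Q : PrimeSpectrum (R ⧸ Ideal.span {c}),
      (Q.comap (Ideal.Quotient.mk (Ideal.span {c}))).asIdeal.height ≤ 1 := by
  obtain ⟨P, hP⟩ := Ideal.nonempty_minimalPrimes (I := Ideal.span {c})
    (by rwa [Ne, Ideal.span_singleton_eq_top])
  have := hP.1.1
  obtain ⟨Q, hQ⟩ : (⟨P, hP.1.1⟩ : PrimeSpectrum R) ∈
      Set.range (PrimeSpectrum.comap (Ideal.Quotient.mk (Ideal.span {c}))) := by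
    rw [range_comap_of_surjective _ _ Ideal.Quotient.mk_surjective, Ideal.mk_ker]
    exact hP.1.2
  refine ⟨Q, ?_⟩
  rw [hQ]
  exact Ideal.height_le_one_of_isPrincipal_of_mem_minimalPrimes (Ideal.span {c}) P hP

end QuasiLifting

theorem mainTheorem1 (S : Scheme.{u}) (hne : Nonempty S) (hS : QuasiLifting.IsPoonenScheme S)
    (X : Scheme.{u}) (f : X ⟶ S) (hfp : QuasiLifting.IsOfFinitePresentation f)
    (hdom : IsDominant f) :
    (∃ (S' : Scheme.{u}) (i : S' ⟶ S), Nonempty S' ∧ QuasiLifting.IsPrincipalImmersion i ∧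
      QuasiLifting.IsQuasiLiftable f i ∧ (Smooth f → QuasiLifting.IsLiftable f i)) ∧
    (IsLocallyNoetherian S →
      (∃ s ∈ QuasiLifting.QRel f, ringKrullDim (S.presheaf.stalk s) ≤ 1) ∧
      (Smooth f → ∃ s ∈ QuasiLifting.Rel f, ringKrullDim (S.presheaf.stalk s) ≤ 1)) ∧
    (JacobsonSpace S →
      (∃ s ∈ QuasiLifting.QRel f, IsClosed ({s} : Set S)) ∧
      (Smooth f → ∃ s ∈ QuasiLifting.Rel f, IsClosed ({s} : Set S))) := by
  have := hfp.locallyOfFinitePresentation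
  have := hfp.quasiCompact
  obtain ⟨R, _, c, i, _, hc, hql, hl⟩ := hS.exists_isQuasiLiftable f
  have hk := QuasiLifting.isClosedImmersionByOneEquation_quotient c
  set k := Spec.map (CommRingCat.ofHom (Ideal.Quotient.mk (Ideal.span {c})))
  have := hk.isClosedImmersion
  have : Nontrivial (R ⧸ Ideal.span {c}) :=
    Ideal.Quotient.nontrivial_iff.mpr (by rwa [Ne, Ideal.span_singleton_eq_top])
  have hne' : Nonempty (Spec (.of (R ⧸ Ideal.span {c}))) :=
    inferInstanceAs (Nonempty (PrimeSpectrum (R ⧸ Ideal.span {c})))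
  refine ⟨⟨_, k ≫ i, hne', ⟨_, k, i, hk, ‹_›, rfl⟩, hql, hl⟩, fun hN ↦ ?_, fun hJ ↦ ?_⟩
  · have := isLocallyNoetherian_of_isOpenImmersion i
    have : IsNoetherianRing R := isLocallyNoetherian_Spec.mp this
    obtain ⟨Q, hQ⟩ := QuasiLifting.exists_mem_range_height_le_one hc
    have hdim : ringKrullDim (S.presheaf.stalk ((k ≫ i) Q)) ≤ 1 := by
      refine (QuasiLifting.ringKrullDim_stalk_of_isOpenImmersion i _).trans_le ?_
      exact_mod_cast hQ
    exact ⟨⟨_, hql.mem_QRel Q, hdim⟩, fun h ↦ ⟨_, (hl h).mem_Rel Q, hdim⟩⟩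
  · obtain ⟨_, ⟨Q, rfl⟩, hQ⟩ := nonempty_inter_closedPoints (Set.range_nonempty (k ≫ i))
      (k ≫ i).isLocallyClosed_range
    exact ⟨⟨_, hql.mem_QRel Q, hQ⟩, fun h ↦ ⟨_, (hl h).mem_Rel Q, hQ⟩⟩
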